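/- Let $D\ge 1$. For strings $w_1^k, z_1^m$ over $\{1,\dots,D\}$ let $c(w_1^k|z_1^m)=\sum_{i=0}^{m-k}\mathbf 1\{w_1^k=z_{i+1}^{i+k}\}$ (an empty sum is $0$), and let $\mathbf L(z_1^m)=\max\{k:\exists w_1^k,\ c(w_1^k|z_1^m)>1\}$ be the maximal length of a string that appears at least twice in $z_1^m$. Put $B(x_{n+1}|x_1^n,-1)=D^{-1}$ and, for $0\le k\le n$, $$B(x_{n+1}|x_1^n,k)=\frac{c(x_{n+1-k}^{n+1}|x_1^n)+B(x_{n+1}|x_1^n,k-1)}{c(x_{n+1-k}^{n}|x_1^{n-1})+1}.$$ Let $p_n\in(0,1)$ for $n\ge 0$ satisfy $\prod_{n=0}^\infty p_n>0$, and let $q_n=1-p_n$. The plain switch distribution is $P(x_1^n)=\sum_{k=-1}^{n-1}P(x_1^n,k)$, where $P(x_1,-1)=p_0B(x_1|-1)$, $P(x_1,0)=q_0B(x_1|0)$ (with $B(x_1|k)$ denoting $B(x_{n+1}|x_1^n,k)$ for $n=0$), $P(x_1^n,k)=0$ for $k<-1$ or $k\ge n$, and $P(x_1^{n+1},k)=[p_nP(x_1^n,k)+q_nP(x_1^n,k-1)]\,B(x_{n+1}|x_1^n,k)$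 for $n\ge1$ and $-1\le k\le n$. Theorem. The value $P(x_1^n)$ can be computed in time $O(ns)$, where $s=\mathbf L(x_1^n)$. Precisely: there is a single program for a unit-cost random access machine, with words of $O(\log (n+2))$ bits and exact real registers that admit only the four arithmetic operations, which, given $n$, $D$, the letters of $x_1^n$ and the coefficients $p_0,\dots,p_{n-1}$, outputs $P(x_1^n)$ for all $n\ge1$ and all such data after at most $C\max(1,ns)$ steps. The constant $C$ and the constant in the word length depend only on $D$. -/

import Mathlib

open Filter Topology

noncomputable section

namespace PlainSwitch

/-! ### Strings, substring frequencies and depth -/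

/-- The block `x_{i+1}, …, x_{i+l}` of the string `x = x_1 … x_n`. -/
def block {α : Type} (x : List α) (i l : ℕ) : List α := (x.drop i).take l

/-- The frequency `c(w | z)`: the number of positions `0 ≤ i ≤ |z| - |w|` at which `w` occurs
in `z` (no position at all if `|w| > |z|`). Overlapping occurrences all count. -/
def freq {α : Type} [DecidableEq α] (w z : List α) : ℕ :=
  ∑ i ∈ Finset.range (z.length + 1 - w.length), if block z i w.length = w then 1 else 0

/-- The depth `L(z)`: the largest length of a string that occurs at least twice in `z`.
(For nonempty `z` the empty string occurs at least twice, and no string of length `|z|` or more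
does, so this is the maximum of a nonempty bounded set.) -/
def depth {α : Type} [DecidableEq α] (z : List α) : ℕ :=
  sSup {k : ℕ | ∃ w : List α, w.length = k ∧ 1 < freq w z}

/-! ### The plain switch distribution

Orders `k = -1, 0, 1, …` are shifted by one: the index `j : ℕ` below stands for the order
`k = j - 1`. -/

/-- The number of occurrences `c(x_{n+1-k}^n | x_1^{n-1})` of the context of length `k`.
For `n = 0` the defining sum `∑_{i=0}^{n-1-k}` is empty. -/
def contextFreq {D : ℕ} (x : List (Fin D)) (n k : ℕ) : ℕ :=
  if n = 0 then 0 else freq (block x (n - k) k) (x.take (n - 1))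

/-- The adaptive Markov probability `B(x_{n+1} | x_1^n, j - 1)`, meant for `n < |x|` and
`j - 1 ≤ n`. -/
def markov {D : ℕ} (x : List (Fin D)) (n : ℕ) : ℕ → ℝ
  | 0 => 1 / (D : ℝ)
  | k + 1 =>
      ((freq (block x (n - k) (k + 1)) (x.take n) : ℝ) + markov x n k) /
        ((contextFreq x n k : ℝ) + 1)

/-- Admissible coefficients: `p_n ∈ (0, 1)` and `∏_{n=0}^∞ p_n > 0`. -/
def IsSwitchCoeff (p : ℕ → ℝ) : Prop :=
  (∀ n, 0 < p n ∧ p n < 1) ∧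
    ∃ a : ℝ, 0 < a ∧ Tendsto (fun N => ∏ i ∈ Finset.range N, p i) atTop (𝓝 a)

/-- The partial switch distribution `P(x_1^n, j - 1)`, for `1 ≤ n ≤ |x|`
(the value `0` at `n = 0` is not used). -/
def partialSwitch {D : ℕ} (p : ℕ → ℝ) (x : List (Fin D)) : ℕ → ℕ → ℝ
  | 0, _ => 0
  | 1, 0 => p 0 * markov x 0 0
  | 1, 1 => (1 - p 0) * markov x 0 1
  | 1, _ + 2 => 0
  | m + 2, 0 => p (m + 1) * partialSwitch p x (m + 1) 0 * markov x (m + 1) 0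
  | m + 2, k + 1 =>
      if k ≤ m + 1 then
        (p (m + 1) * partialSwitch p x (m + 1) (k + 1)
          + (1 - p (m + 1)) * partialSwitch p x (m + 1) k) * markov x (m + 1) (k + 1)
      else 0

/-- The plain switch distribution `P(x_1^n) = ∑_{k=-1}^{n-1} P(x_1^n, k)`, where `n = |x|`. -/
def switchProb {D : ℕ} (p : ℕ → ℝ) (x : List (Fin D)) : ℝ :=
  ∑ j ∈ Finset.range (x.length + 1), partialSwitch p x x.length j

/-! ### A random access machine with unit cost

The machine has word registers and word arrays, holding natural numbers, and real registers and
real arrays, holding real numbers. Registers and arrays are named by constants of the program, so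
a program uses finitely many of them; array cells are addressed by word registers. Real numbers
are handled exactly, by the four arithmetic operations only, and nothing flows back from the real
numbers to the words or to the control. Words are bounded: an operation whose result exceeds the
capacity `W` cannot be executed, and neither can a division by zero. -/

/-- Instructions; `d` is the destination, `a b` are operands, `A` is the name of an array, `i` the
word register that holds the address. -/
inductive Instr : Type
  | wconst (d c : ℕ)
  | wcopy (d a : ℕ)
  | wadd (d a b : ℕ)
  | wsub (d a b : ℕ)
  | wmul (d a b : ℕ)
  | wload (d A i : ℕ)
  | wstore (A i a : ℕ)
  | rofword (d a : ℕ)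
  | radd (d a b : ℕ)
  | rsub (d a b : ℕ)
  | rmul (d a b : ℕ)
  | rdiv (d a b : ℕ)
  | rload (d A i : ℕ)
  | rstore (A i a : ℕ)

/-- A test compares two word registers. -/
inductive Test : Type
  | lt (a b : ℕ)
  | eq (a b : ℕ)

/-- Programs. -/
inductive Prog : Type
  | skip
  | instr (c : Instr)
  | seq (P Q : Prog)
  | ite (b : Test) (P Q : Prog)
  | while (b : Test) (P : Prog)

/-- A configuration of the memory. -/
structure Mem : Type where
  word : ℕ → ℕ
  real : ℕ → ℝ
  warr : ℕ → ℕ → ℕ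
  rarr : ℕ → ℕ → ℝ

/-- The array `f` with the content of cell `i` of array `A` replaced by `v`. -/
def setCell {β : Type} (f : ℕ → ℕ → β) (A i : ℕ) (v : β) : ℕ → ℕ → β :=
  Function.update f A (Function.update (f A) i v)

/-- The condition under which an instruction can be executed with word capacity `W`. -/
def Instr.Enabled (W : ℕ) : Instr → Mem → Prop
  | .wconst _ c, _ => c ≤ W
  | .wadd _ a b, σ => σ.word a + σ.word b ≤ W
  | .wmul _ a b, σ => σ.word a * σ.word b ≤ W
  | .rdiv _ _ b, σ => σ.real b ≠ 0
  | _, _ => True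

/-- The effect of an instruction (subtraction of words is truncated at `0`). -/
def Instr.apply : Instr → Mem → Mem
  | .wconst d c, σ => { σ with word := Function.update σ.word d c }
  | .wcopy d a, σ => { σ with word := Function.update σ.word d (σ.word a) }
  | .wadd d a b, σ => { σ with word := Function.update σ.word d (σ.word a + σ.word b) }
  | .wsub d a b, σ => { σ with word := Function.update σ.word d (σ.word a - σ.word b) }
  | .wmul d a b, σ => { σ with word := Function.update σ.word d (σ.word a * σ.word b) }
  | .wload d A i, σ => { σ with word := Function.update σ.word d (σ.warr A (σ.word i)) }
  | .wstore A i a, σ => { σ with warr := setCell σ.warr A (σ.word i) (σ.word a) }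
  | .rofword d a, σ => { σ with real := Function.update σ.real d (σ.word a : ℝ) }
  | .radd d a b, σ => { σ with real := Function.update σ.real d (σ.real a + σ.real b) }
  | .rsub d a b, σ => { σ with real := Function.update σ.real d (σ.real a - σ.real b) }
  | .rmul d a b, σ => { σ with real := Function.update σ.real d (σ.real a * σ.real b) }
  | .rdiv d a b, σ => { σ with real := Function.update σ.real d (σ.real a / σ.real b) }
  | .rload d A i, σ => { σ with real := Function.update σ.real d (σ.rarr A (σ.word i)) }
  | .rstore A i a, σ => { σ with rarr := setCell σ.rarr A (σ.word i) (σ.real a) }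

/-- The outcome of a test. -/
def Test.Holds : Test → Mem → Prop
  | .lt a b, σ => σ.word a < σ.word b
  | .eq a b, σ => σ.word a = σ.word b

/-- `Exec W P σ τ t`: with word capacity `W`, the program `P` started in the memory `σ` halts in
the memory `τ` after exactly `t` steps. Every instruction and every evaluation of a test is one
step. -/
inductive Exec (W : ℕ) : Prog → Mem → Mem → ℕ → Prop
  | skip (σ : Mem) : Exec W .skip σ σ 1
  | instr (c : Instr) (σ : Mem) (h : c.Enabled W σ) : Exec W (.instr c) σ (c.apply σ) 1
  | seq {P Q : Prog} {σ σ' τ : Mem} {t u : ℕ} (h₁ : Exec W P σ σ' t) (h₂ : Exec W Q σ' τ u) :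
      Exec W (.seq P Q) σ τ (t + u)
  | iteTrue {b : Test} {P Q : Prog} {σ τ : Mem} {t : ℕ} (hb : b.Holds σ) (h : Exec W P σ τ t) :
      Exec W (.ite b P Q) σ τ (t + 1)
  | iteFalse {b : Test} {P Q : Prog} {σ τ : Mem} {t : ℕ} (hb : ¬ b.Holds σ)
      (h : Exec W Q σ τ t) : Exec W (.ite b P Q) σ τ (t + 1)
  | whileTrue {b : Test} {P : Prog} {σ σ' τ : Mem} {t u : ℕ} (hb : b.Holds σ)
      (h₁ : Exec W P σ σ' t) (h₂ : Exec W (.while b P) σ' τ u) :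
      Exec W (.while b P) σ τ (t + u + 1)
  | whileFalse {b : Test} {P : Prog} {σ : Mem} (hb : ¬ b.Holds σ) : Exec W (.while b P) σ σ 1

/-- The input: word registers `0` and `1` hold `n = |x|` and `D`; word array `0` holds the letters
`x_1, …, x_n` as numbers `0, …, D - 1`; real array `0` holds `p_0, …, p_{n-1}`; everything else
is `0`. -/
def input {D : ℕ} (p : ℕ → ℝ) (x : List (Fin D)) : Mem where
  word r := if r = 0 then x.length else if r = 1 then D else 0
  real _ := 0
  warr A i := if A = 0 then (x.map Fin.val).getD i 0 else 0
  rarr A i := if A = 0 ∧ i < x.length then p i else 0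

end PlainSwitch

end

noncomputable section
namespace PlainSwitch

/-! ### Context counts as a function of the context length and of the position -/

/-! The table of all `P(x_1^n, k)` has quadratic size, but it can be filled order by order, and only
about `depth x` orders need work.

One order costs linear time. In `B`, the denominator uses the number of earlier repetitions of the
context of length `k` ending at `n`, and the numerator uses the same quantity for length `k + 1`
ending at `n + 1` (`contextFreq_eq`, `ctx_freq`). Two contexts of length `k + 1` agree iff their
prefixes of length `k` agree and their last letters agree (`ctx_succ_eq_iff`). So if every context
of length `k` is named by the first position where it ends, the pair (name, letter) identifies the
extended context. Used as a table address (`ctxKey`), it gives its count and its name in constant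
time. Addresses include the level, so each level finds untouched cells and nothing has to be
cleared.

Once no context of length `K` repeats, all longer contexts have count zero, and the Markov
probabilities no longer depend on the order (`markovAux_const`). The mass of all remaining orders
then obeys a scalar recurrence (`tailMass_eq`), computed in one more pass. A repetition at level `k`
forces `k ≤ depth x` (`le_depth`), so at most `depth x + 1` levels follow level `0`. For `depth x =
0` the pigeonhole principle bounds the length by `D`; otherwise the cost is absorbed by the product
of length and depth. -/

/-- The block of length `k` that ends at position `n`. -/
def ctx {α : Type} (x : List α) (k n : ℕ) : List α := block x (n - k) k

/-- The letter at position `i`, as a number. -/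
def letter {D : ℕ} (x : List (Fin D)) (i : ℕ) : ℕ := (x.map Fin.val).getD i 0

/-- The number of earlier positions with the same context of length `k` as position `n`. -/
def ctxCount {α : Type} [DecidableEq α] (x : List α) (k n : ℕ) : ℕ :=
  if k ≤ n then ((Finset.range n).filter fun i => k ≤ i ∧ ctx x k i = ctx x k n).card else 0

/-- The first position with the same context of length `k` as position `n`. -/
def ctxRep {α : Type} (x : List α) (k n : ℕ) : ℕ :=
  if k ≤ n then sInf {i | k ≤ i ∧ ctx x k i = ctx x k n} else 0

variable {D : ℕ} {x : List (Fin D)}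

theorem letter_lt {i : ℕ} (hi : i < x.length) : letter x i < D := by
  simp [letter, hi]

theorem letter_eq_iff {i n : ℕ} (hi : i < x.length) (hn : n < x.length) :
    letter x i = letter x n ↔ x[i] = x[n] := by
  simp [letter, hi, hn, Fin.val_inj]

theorem ctx_succ {α : Type} {x : List α} {k n : ℕ} (hk : k ≤ n) (hn : n < x.length) :
    ctx x (k + 1) (n + 1) = ctx x k n ++ [x[n]] := by
  have h : n - k + k = n := by omega
  have h2 : k < (x.drop (n - k)).length := by simp; omega
  simp only [ctx, block, Nat.add_sub_add_right]
  rw [List.take_succ_eq_append_getElem h2]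
  simp [h]

theorem ctx_succ_eq_iff {k i n : ℕ} (hki : k ≤ i) (hkn : k ≤ n) (hi : i < x.length)
    (hn : n < x.length) :
    ctx x (k + 1) (i + 1) = ctx x (k + 1) (n + 1) ↔
      ctx x k i = ctx x k n ∧ letter x i = letter x n := by
  rw [ctx_succ hki hi, ctx_succ hkn hn, letter_eq_iff hi hn]
  simp [List.append_eq_append_iff_of_size_eq_right]

section rep
variable {α : Type} {x : List α}

theorem ctxRep_mem {k n : ℕ} (h : k ≤ n) :
    k ≤ ctxRep x k n ∧ ctx x k (ctxRep x k n) = ctx x k n := by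
  rw [ctxRep, if_pos h]
  exact Nat.sInf_mem (s := {i | k ≤ i ∧ ctx x k i = ctx x k n}) ⟨n, h, rfl⟩

theorem ctxRep_le (k n : ℕ) : ctxRep x k n ≤ n := by
  unfold ctxRep
  split_ifs with h
  · exact Nat.sInf_le ⟨h, rfl⟩
  · exact Nat.zero_le _

theorem ctxRep_eq_iff {k i n : ℕ} (hi : k ≤ i) (hn : k ≤ n) :
    ctxRep x k i = ctxRep x k n ↔ ctx x k i = ctx x k n := by
  constructor
  · intro h
    rw [← (ctxRep_mem hi).2, h, (ctxRep_mem hn).2]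
  · intro h
    rw [ctxRep, ctxRep, if_pos hi, if_pos hn, h]

theorem ctxRep_of_lt {k n : ℕ} (h : n < k) : ctxRep x k n = 0 := if_neg (by omega)

theorem ctxCount_of_lt [DecidableEq α] {k n : ℕ} (h : n < k) : ctxCount x k n = 0 := if_neg (by omega)

theorem ctxCount_le [DecidableEq α] (k n : ℕ) : ctxCount x k n ≤ n := by
  unfold ctxCount
  split_ifs with h
  · exact (Finset.card_filter_le _ _).trans (by simp)
  · exact Nat.zero_le _

theorem ctxCount_pos_iff [DecidableEq α] {k n : ℕ} :
    0 < ctxCount x k n ↔ ∃ i < n, k ≤ i ∧ ctx x k i = ctx x k n := by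
  unfold ctxCount
  split_ifs with h
  · simp only [Finset.card_pos, Finset.Nonempty, Finset.mem_filter, Finset.mem_range]
  · simp only [lt_self_iff_false, false_iff, not_exists, not_and]
    intro i hi hk
    omega

/-- A context met for the first time is named by its own end position, so the program can create the
name without a search. -/
theorem ctxRep_of_ctxCount_eq_zero [DecidableEq α] {k n : ℕ} (hk : k ≤ n) (h : ctxCount x k n = 0) :
    ctxRep x k n = n := by
  by_contra hne
  have := ctxRep_mem (x := x) hk
  have hlt := (ctxRep_le (x := x) k n).lt_of_ne hne
  have := ctxCount_pos_iff.2 ⟨_, hlt, this⟩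
  omega

theorem ctxRep_zero (n : ℕ) : ctxRep x 0 n = 0 := by
  simp [ctxRep, ctx, block]

theorem ctxCount_zero [DecidableEq α] (n : ℕ) : ctxCount x 0 n = n := by
  simp [ctxCount, ctx, block]

theorem ctx_of_ctx_succ {k i n : ℕ} (hi : k + 1 ≤ i) (hn : k + 1 ≤ n)
    (h : ctx x (k + 1) i = ctx x (k + 1) n) : ctx x k i = ctx x k n := by
  have h2 := congrArg (List.drop 1) h
  simp only [ctx, block, List.drop_take, List.drop_drop] at h2
  simpa [ctx, block, show i - (k + 1) + 1 = i - k by omega,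
    show n - (k + 1) + 1 = n - k by omega] using h2

/-- A repetition of a context is also a repetition of each of its suffixes. -/
theorem ctxCount_eq_zero_succ [DecidableEq α] {k n : ℕ} (h : ctxCount x k n = 0) : ctxCount x (k + 1) n = 0 := by
  by_contra hne
  obtain ⟨i, hin, hki, he⟩ := ctxCount_pos_iff.1 (Nat.pos_of_ne_zero hne)
  have := ctxCount_pos_iff.2 ⟨i, hin, by omega, ctx_of_ctx_succ hki (by omega) he⟩
  omega

theorem ctxCount_eq_zero_of_le [DecidableEq α] {k k' n : ℕ} (hkk : k ≤ k') (h : ctxCount x k n = 0) :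
    ctxCount x k' n = 0 := by
  induction k', hkk using Nat.le_induction with
  | base => exact h
  | succ m _ ih => exact ctxCount_eq_zero_succ ih

end rep

/-! ### Substring frequencies as context counts -/

theorem block_length {α : Type} {x : List α} {i l : ℕ} (h : i + l ≤ x.length) :
    (block x i l).length = l := by
  simp [block]; omega

theorem block_take {α : Type} {x : List α} {i l m : ℕ} (h : i + l ≤ m) :
    block (x.take m) i l = block x i l := by
  simp only [block, List.drop_take, List.take_take]
  rw [min_eq_left (by omega)]

/-- An occurrence starting at `i` ends at `i + k`; deleting the last letter of `x_1^n` excludes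
exactly the occurrence ending at `n`. -/
theorem contextFreq_eq {n k : ℕ} (hk : k ≤ n) (hn : n ≤ x.length) :
    contextFreq x n k = ctxCount x k n := by
  rcases Nat.eq_zero_or_pos n with rfl | h0
  · simp [contextFreq, ctxCount]
  rw [contextFreq, if_neg h0.ne', freq, block_length (by omega), ctxCount, if_pos hk,
    Finset.card_filter, List.length_take, min_eq_left (by omega),
    show n - 1 + 1 - k = n - k by omega]
  have hs : ∑ i ∈ Finset.range k, (if k ≤ i ∧ ctx x k i = ctx x k n then 1 else 0) = 0 :=
    Finset.sum_eq_zero fun i hi => if_neg fun h => by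
      have := Finset.mem_range.1 hi
      omega
  have ha := Finset.sum_range_add
    (fun i => if k ≤ i ∧ ctx x k i = ctx x k n then 1 else 0) k (n - k)
  rw [hs, zero_add, Nat.add_sub_cancel' hk] at ha
  refine Eq.trans ?_ ha.symm
  refine Finset.sum_congr rfl fun i hi => ?_
  have hi' := Finset.mem_range.1 hi
  rw [block_take (by omega)]
  simp [ctx]

theorem ctx_freq {n k : ℕ} (hk : k ≤ n) (hn : n < x.length) :
    freq (block x (n - k) (k + 1)) (x.take n) = ctxCount x (k + 1) (n + 1) := by
  rw [← contextFreq_eq (by omega) (by omega)]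
  simp [contextFreq]

/-! ### Depth -/

theorem length_lt_of_freq {α : Type} [DecidableEq α] {x w : List α} (h : 1 < freq w x) :
    w.length < x.length := by
  by_contra hl
  have : freq w x ≤ ∑ i ∈ Finset.range (x.length + 1 - w.length), 1 :=
    Finset.sum_le_sum fun i _ => by split_ifs <;> omega
  simp at this
  omega

theorem depth_lt {α : Type} [DecidableEq α] {x : List α} (hx : x ≠ []) :
    depth x < x.length := by
  have h0 : 0 < x.length := List.length_pos_iff.2 hx
  have : depth x ≤ x.length - 1 := csSup_le' fun k ⟨w, hw, hf⟩ => by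
    have := length_lt_of_freq hf
    omega
  omega

theorem le_depth {k n : ℕ} (hn : n ≤ x.length) (h : 0 < ctxCount x k n) : k ≤ depth x := by
  obtain ⟨i, hin, hki, he⟩ := ctxCount_pos_iff.1 h
  refine le_csSup ⟨x.length, ?_⟩ ⟨ctx x k n, block_length (by omega), ?_⟩
  · rintro _ ⟨w, rfl, hw⟩
    exact (length_lt_of_freq hw).le
  · rw [freq, ctx, block_length (by omega), ← Finset.card_filter]
    refine Finset.one_lt_card.2 ⟨i - k, ?_, n - k, ?_, by omega⟩
    · simp only [Finset.mem_filter, Finset.mem_range]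
      exact ⟨by omega, he⟩
    · simp only [Finset.mem_filter, Finset.mem_range]
      exact ⟨by omega, trivial⟩

/-- With more than `D` letters some letter repeats, and it is a repeated string of length one. -/
theorem length_le_of_depth_eq_zero (h : depth x = 0) : x.length ≤ D := by
  by_contra hD
  obtain ⟨i, j, hij, he⟩ := Fintype.exists_ne_map_eq_of_card_lt
    (fun i : Fin x.length => x[i]) (by simpa using hD)
  wlog hlt : i < j generalizing i j
  · exact this j i hij.symm he.symm (lt_of_le_of_ne (not_lt.1 hlt) hij.symm)
  have := le_depth (x := x) (k := 1) (n := j + 1) (by omega) (ctxCount_pos_iff.2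
    ⟨i + 1, by simpa using hlt, by omega, ?_⟩)
  · omega
  · rw [ctx_succ_eq_iff (by omega) (by omega) i.2 j.2, letter_eq_iff i.2 j.2]
    exact ⟨by simp [ctx, block], he⟩

/-! ### The switch distribution in terms of context counts -/

/-- The adaptive Markov probability of order `j - 1`, extended constantly to orders above `n`. -/
def markovAux (x : List (Fin D)) (n : ℕ) : ℕ → ℝ
  | 0 => 1 / (D : ℝ)
  | k + 1 => ((ctxCount x (k + 1) (n + 1) : ℝ) + markovAux x n k) / ((ctxCount x k n : ℝ) + 1)

/-- The partial switch distribution, started at `n = 0` with mass one on the order `-1`. -/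
def partialAux (p : ℕ → ℝ) (x : List (Fin D)) : ℕ → ℕ → ℝ
  | 0, 0 => 1
  | 0, _ + 1 => 0
  | n + 1, 0 => p n * partialAux p x n 0 * markovAux x n 0
  | n + 1, j + 1 =>
      (p n * partialAux p x n (j + 1) + (1 - p n) * partialAux p x n j) * markovAux x n (j + 1)

theorem markov_eq {n j : ℕ} (hn : n < x.length) (hj : j ≤ n + 1) :
    markov x n j = markovAux x n j := by
  induction j with
  | zero => rfl
  | succ k ih =>
    rw [markov, markovAux, ih (by omega), ctx_freq (by omega) hn,
      contextFreq_eq (by omega) hn.le]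

variable {p : ℕ → ℝ}

/-- Each step raises the order by at most one. Hence the recurrence needs no cutoff, whatever values
`markovAux` takes at the excess orders. -/
theorem partialAux_of_lt {n j : ℕ} (h : n < j) : partialAux p x n j = 0 := by
  induction n generalizing j with
  | zero =>
    obtain ⟨i, rfl⟩ : ∃ i, j = i + 1 := ⟨j - 1, by omega⟩
    rfl
  | succ n ih =>
    obtain ⟨i, rfl⟩ : ∃ i, j = i + 1 := ⟨j - 1, by omega⟩
    rw [partialAux, ih (by omega), ih (by omega)]
    simp

theorem partialSwitch_eq {n : ℕ} (hn : n + 1 ≤ x.length) (j : ℕ) :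
    partialSwitch p x (n + 1) j = partialAux p x (n + 1) j := by
  induction n generalizing j with
  | zero =>
    match j with
    | 0 => simp [partialSwitch, partialAux, markov_eq hn]
    | 1 => simp [partialSwitch, partialAux, markov_eq hn]
    | j + 2 => rw [partialAux_of_lt (by omega), partialSwitch]
  | succ n ih =>
    match j with
    | 0 => rw [partialSwitch, partialAux, ih (by omega), markov_eq (by omega) (by omega)]
    | j + 1 =>
      rw [partialSwitch]
      split_ifs with h
      · rw [partialAux, ih (by omega), ih (by omega), markov_eq (by omega) (by omega)]
      · rw [partialAux_of_lt (by omega)]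

theorem switchProb_eq (hx : x ≠ []) :
    switchProb p x = ∑ j ∈ Finset.range (x.length + 1), partialAux p x x.length j := by
  have h0 : 0 < x.length := List.length_pos_iff.2 hx
  refine Finset.sum_congr rfl fun j _ => ?_
  rw [show x.length = x.length - 1 + 1 by omega]
  exact partialSwitch_eq (by omega) j

/-- The total mass of the orders above a level from which on the Markov probabilities agree. -/
def tailMass (p : ℕ → ℝ) (x : List (Fin D)) (K : ℕ) : ℕ → ℝ
  | 0 => 0
  | n + 1 => (tailMass p x K n + (1 - p n) * partialAux p x n K) * markovAux x n K

/-- With both counts zero the recursion for `B` adds `0` and divides by `1`. -/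
theorem markovAux_const {K n : ℕ} (h0 : ctxCount x K n = 0) (h1 : ctxCount x K (n + 1) = 0)
    (i : ℕ) : markovAux x n (K + i) = markovAux x n K := by
  induction i with
  | zero => rfl
  | succ i ih =>
    rw [← add_assoc, markovAux, ih, ctxCount_eq_zero_of_le (by omega) h0,
      ctxCount_eq_zero_of_le (by omega) h1]
    simp

/-- Summing the recurrence over the orders above `K`, the common Markov factor comes out; since `p n
+ (1 - p n) = 1`, the tail keeps its mass and gains only what moves up from level `K`. -/
theorem tailMass_eq {K N : ℕ} (h : ∀ m ≤ N, ctxCount x K m = 0) (hK : 0 < K) {n : ℕ}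
    (hn : n ≤ N) :
    tailMass p x K n = ∑ i ∈ Finset.range N, partialAux p x n (K + i + 1) := by
  induction n with
  | zero => simp [tailMass, partialAux]
  | succ n ih =>
    rw [tailMass, ih (by omega)]
    -- Shifting the index by one gains the term at `K` and loses the one at `K + N`, which vanishes
    -- because `n < K + N`.
    have hs := Finset.sum_range_succ' (fun i => partialAux p x n (K + i)) N
    rw [Finset.sum_range_succ, partialAux_of_lt (j := K + N) (by omega)] at hs
    have hr : ∀ i ∈ Finset.range N, partialAux p x (n + 1) (K + i + 1) =
        p n * markovAux x n K * partialAux p x n (K + i + 1) +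
          (1 - p n) * markovAux x n K * partialAux p x n (K + i) := by
      intro i _
      rw [partialAux, add_assoc K i 1, markovAux_const (h n (by omega)) (h (n + 1) hn)]
      ring
    rw [Finset.sum_congr rfl hr, Finset.sum_add_distrib, ← Finset.mul_sum, ← Finset.mul_sum]
    simp only [← add_assoc, add_zero] at hs
    rw [hs]
    ring

theorem switchProb_eq_add_tailMass (hx : x ≠ []) {K : ℕ} (hK : 0 < K)
    (h : ∀ m ≤ x.length, ctxCount x K m = 0) :
    switchProb p x = ∑ j ∈ Finset.range (K + 1), partialAux p x x.length j +
      tailMass p x K x.length := by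
  rw [switchProb_eq hx, tailMass_eq h hK le_rfl]
  -- The sum is padded with `K` vanishing orders so that it can be split again after order `K`.
  have hs := Finset.sum_range_add (fun j => partialAux p x x.length j) (x.length + 1) K
  rw [Finset.sum_eq_zero (s := Finset.range K) fun i _ => partialAux_of_lt (by omega),
    show x.length + 1 + K = K + 1 + x.length by omega, Finset.sum_range_add, add_zero] at hs
  rw [← hs]
  congr 1
  exact Finset.sum_congr rfl fun i _ => by rw [add_right_comm]

/-! ### Addresses of extended contexts -/

/-- The table address that represents the context of length `k + 1` ending at `n + 1`. -/
def ctxKey (x : List (Fin D)) (k n : ℕ) : ℕ :=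
  ((k + 1) * (x.length + 1) + ctxRep x k n) * D + letter x n

theorem le_ctxKey (k n : ℕ) : (k + 1) * (x.length + 1) * D ≤ ctxKey x k n := by
  unfold ctxKey
  nlinarith [Nat.zero_le (ctxRep x k n * D), Nat.zero_le (letter x n)]

/-- Together with `le_ctxKey` this gives the levels disjoint address intervals. -/
theorem ctxKey_lt {k n : ℕ} (hn : n < x.length) :
    ctxKey x k n < (k + 2) * (x.length + 1) * D := by
  have h1 : (k + 1) * (x.length + 1) + ctxRep x k n + 1 ≤ (k + 2) * (x.length + 1) := by
    have := ctxRep_le (x := x) k n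
    nlinarith
  have h2 := Nat.mul_le_mul_right D h1
  have := letter_lt hn
  unfold ctxKey
  nlinarith

/-- The letter is the last digit in base `D`, so division with remainder recovers both name and
letter. -/
theorem ctxKey_eq_iff {k i n : ℕ} (hki : k ≤ i) (hkn : k ≤ n) (hi : i < x.length)
    (hn : n < x.length) :
    ctxKey x k i = ctxKey x k n ↔ ctx x (k + 1) (i + 1) = ctx x (k + 1) (n + 1) := by
  have h1 := letter_lt hi
  have h2 := letter_lt hn
  have hD : 0 < D := by omega
  rw [ctx_succ_eq_iff hki hkn hi hn, ← ctxRep_eq_iff hki hkn]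
  constructor
  · intro h
    have hm := congrArg (· % D) h
    have hd := congrArg (· / D) h
    simp only [ctxKey, Nat.mul_add_mod_self_right, Nat.mod_eq_of_lt h1, Nat.mod_eq_of_lt h2] at hm
    simp only [ctxKey, mul_comm _ D, Nat.mul_add_div hD, Nat.div_eq_of_lt h1,
      Nat.div_eq_of_lt h2] at hd
    exact ⟨by omega, hm⟩
  · rintro ⟨h, h'⟩
    rw [ctxKey, ctxKey, h, h']

theorem ctxCount_succ_eq {k n : ℕ} (hk : k ≤ n) (hn : n < x.length) :
    ctxCount x (k + 1) (n + 1) =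
      ((Finset.Ico k n).filter fun m => ctxKey x k m = ctxKey x k n).card := by
  rw [ctxCount, if_pos (by omega)]
  refine (Finset.card_bij (fun m _ => m + 1) ?_ ?_ ?_).symm
  · intro m hm
    simp only [Finset.mem_filter, Finset.mem_Ico, Finset.mem_range] at hm ⊢
    exact ⟨by omega, by omega, (ctxKey_eq_iff hm.1.1 hk (by omega) hn).1 hm.2⟩
  · intro a _ b _ h
    omega
  · intro b hb
    simp only [Finset.mem_filter, Finset.mem_range] at hb
    obtain ⟨m, rfl⟩ : ∃ m, b = m + 1 := ⟨b - 1, by omega⟩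
    refine ⟨m, ?_, rfl⟩
    simp only [Finset.mem_filter, Finset.mem_Ico]
    exact ⟨by omega, (ctxKey_eq_iff (by omega) hk (by omega) hn).2 hb.2.2⟩

/-! ### Programs with time bounds -/

theorem setCell_apply {β : Type} (f : ℕ → ℕ → β) (A i : ℕ) (v : β) (A' i' : ℕ) :
    setCell f A i v A' i' = if A' = A ∧ i' = i then v else f A' i' := by
  unfold setCell
  by_cases hA : A' = A
  · subst hA
    by_cases hi : i' = i <;> simp [hi]
  · simp [hA]

/-- From `σ` the program halts within `T` steps in a memory that satisfies `Q`. -/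
def Reaches (W : ℕ) (P : Prog) (σ : Mem) (Q : Mem → Prop) (T : ℕ) : Prop :=
  ∃ τ t, Exec W P σ τ t ∧ Q τ ∧ t ≤ T

theorem Reaches.seq {W : ℕ} {P P' : Prog} {σ : Mem} {Q R : Mem → Prop} {T T' : ℕ}
    (h : Reaches W P σ Q T) (h' : ∀ τ, Q τ → Reaches W P' τ R T') :
    Reaches W (.seq P P') σ R (T + T') := by
  obtain ⟨τ, t, he, hQ, ht⟩ := h
  obtain ⟨τ', t', he', hR, ht'⟩ := h' τ hQ
  exact ⟨τ', t + t', .seq he he', hR, by omega⟩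

theorem Reaches.mono {W : ℕ} {P : Prog} {σ : Mem} {Q R : Mem → Prop} {T T' : ℕ}
    (h : Reaches W P σ Q T) (hQ : ∀ τ, Q τ → R τ) (hT : T ≤ T') : Reaches W P σ R T' := by
  obtain ⟨τ, t, he, hq, ht⟩ := h
  exact ⟨τ, t, he, hQ τ hq, ht.trans hT⟩

/-- Straight-line code. -/
def code : List Instr → Prog
  | [] => .skip
  | c :: l => .seq (.instr c) (code l)

/-- The effect of straight-line code. -/
def run : List Instr → Mem → Mem
  | [], σ => σ
  | c :: l, σ => run l (c.apply σ)

/-- The condition under which straight-line code can be executed. -/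
def Runnable (W : ℕ) : List Instr → Mem → Prop
  | [], _ => True
  | c :: l, σ => c.Enabled W σ ∧ Runnable W l (c.apply σ)

theorem exec_code {W : ℕ} {l : List Instr} {σ : Mem} (h : Runnable W l σ) :
    Exec W (code l) σ (run l σ) (l.length + 1) := by
  induction l generalizing σ with
  | nil => exact .skip σ
  | cons c l ih =>
    rw [List.length_cons, show l.length + 1 + 1 = 1 + (l.length + 1) by omega]
    exact .seq (.instr c σ h.1) (ih h.2)

theorem reaches_code {W : ℕ} {l : List Instr} {σ : Mem} {Q : Mem → Prop} (h : Runnable W l σ)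
    (hQ : Q (run l σ)) : Reaches W (code l) σ Q (l.length + 1) :=
  ⟨_, _, exec_code h, hQ, le_rfl⟩

theorem reaches_for {W a b T N : ℕ} {P : Prog} {Inv : ℕ → Mem → Prop}
    (hreg : ∀ n σ, Inv n σ → σ.word a = n ∧ σ.word b = N) {n₀ : ℕ}
    (hstep : ∀ n σ, n₀ ≤ n → n < N → Inv n σ → Reaches W P σ (Inv (n + 1)) T)
    (hn : n₀ ≤ N) {σ : Mem} (h : Inv n₀ σ) :
    Reaches W (.while (.lt a b) P) σ (Inv N) ((N - n₀) * (T + 1) + 1) := by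
  induction hn using Nat.decreasingInduction generalizing σ with
  | self =>
    obtain ⟨ha, hb⟩ := hreg _ _ h
    exact ⟨σ, 1, .whileFalse (by simp [Test.Holds, ha, hb]), h, by omega⟩
  | of_succ n hn ih =>
    obtain ⟨ha, hb⟩ := hreg _ _ h
    obtain ⟨τ, t, he, hI, ht⟩ := hstep n σ le_rfl hn h
    obtain ⟨τ', t', he', hI', ht'⟩ := ih (fun m σ hm => hstep m σ (by omega)) hI
    refine ⟨τ', t + t' + 1, .whileTrue (by simpa [Test.Holds, ha, hb] using hn) he he', hI', ?_⟩
    rw [show N - n = N - (n + 1) + 1 by omega, Nat.add_mul]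
    omega

/-- For a loop whose exit index is not known in advance: only the indices at which it continues are
bounded, by `d`. -/
theorem reaches_while {W a b T d : ℕ} {P : Prog} {Inv : ℕ → Mem → Prop}
    (hle : ∀ k σ, Inv k σ → (Test.lt a b).Holds σ → k ≤ d)
    (hstep : ∀ k σ, Inv k σ → (Test.lt a b).Holds σ → Reaches W P σ (Inv (k + 1)) T)
    {k : ℕ} {σ : Mem} (h : Inv k σ) :
    Reaches W (.while (.lt a b) P) σ (fun τ => ∃ K, Inv K τ ∧ ¬ (Test.lt a b).Holds τ)
      ((d + 1 - k) * (T + 1) + 1) := by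
  induction hm : d + 1 - k generalizing k σ with
  | zero =>
    have hb : ¬ (Test.lt a b).Holds σ := fun hb => by
      have := hle k σ h hb
      omega
    exact ⟨σ, 1, .whileFalse hb, ⟨k, h, hb⟩, by omega⟩
  | succ m ih =>
    by_cases hb : (Test.lt a b).Holds σ
    · obtain ⟨τ, t, he, hI, ht⟩ := hstep k σ h hb
      obtain ⟨τ', t', he', hI', ht'⟩ := ih hI (by omega)
      refine ⟨τ', t + t' + 1, .whileTrue hb he he', hI', ?_⟩
      rw [Nat.add_mul]
      omega
    · exact ⟨σ, 1, .whileFalse hb, ⟨k, h, hb⟩, by omega⟩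

/-! ### The program

Word registers: `0` length, `1` alphabet size, `2` one, `3` length plus one, `4` level, `5`
position, `6` and `7` representative and count of the extended context, `8` sum of the counts of
the level, `9` zero. Word arrays: `0` letters, `1` representatives, `2` counts, `3` and `4` tables
of counts and of representatives by address. Real registers: `0` accumulated mass, `1` one, `2`
partial switch distribution. Real arrays: `0` coefficients, `1` Markov probabilities, `2` partial
switch distribution. -/

/-- Register `8` is set to `1` so that the loop over levels is entered even though level `0` has no
computed total. -/
def initCode : List Instr :=
  [.wconst 2 1, .wadd 3 0 2, .wcopy 8 2, .rofword 1 2, .rofword 3 1, .rdiv 3 1 3, .rofword 2 2]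

def initBody : List Instr :=
  [.wstore 2 5 5, .rstore 1 5 3, .rstore 2 5 2, .rload 4 0 5, .rmul 2 4 2, .rmul 2 2 3,
   .wadd 5 5 2]

/-- The pass starts at position `k`: at smaller positions levels `k` and `k + 1` have the same data.
-/
def levelStart : List Instr :=
  [.wcopy 5 4, .wadd 4 4 2, .wcopy 6 9, .wcopy 7 9, .wcopy 8 9, .rofword 2 9]

/-- The arrays are updated in place, each old entry being read before it is overwritten. The key at
position `n` describes the context ending at `n + 1`, so its name and count wait in registers `6`
and `7` for the next round. The term `(1 - count) * (n + 1)`, with truncated subtraction, replaces a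
case distinction: it is the name of a new context and zero for a known one. -/
def levelBody : List Instr :=
  [.wload 10 1 5, .wstore 1 5 6, .wload 11 2 5, .wstore 2 5 7,
   .wmul 12 4 3, .wadd 12 12 10, .wmul 12 12 1, .wload 13 0 5, .wadd 12 12 13,
   .wload 7 3 12, .wadd 13 7 2, .wstore 3 12 13, .wadd 8 8 7,
   .rload 3 1 5, .rofword 4 7, .radd 3 4 3, .rofword 4 11, .radd 4 4 1, .rdiv 3 3 4,
   .rstore 1 5 3, .rload 4 2 5, .rstore 2 5 2, .rload 5 0 5, .rmul 2 5 2, .rsub 5 1 5,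
   .rmul 4 5 4, .radd 2 2 4, .rmul 2 2 3,
   .wadd 5 5 2, .wsub 13 2 7, .wmul 13 13 5, .wload 6 4 12, .wadd 6 6 13, .wstore 4 12 6]

def tailStart : List Instr := [.wcopy 5 9, .rofword 2 9]

def tailBody : List Instr :=
  [.rload 3 2 5, .rload 4 0 5, .rsub 4 1 4, .rmul 3 4 3, .radd 2 2 3, .rload 3 1 5, .rmul 2 2 3,
   .wadd 5 5 2]

/-- The evaluation of a level. -/
def levelProg : Prog :=
  .seq (code levelStart) (.seq (.while (.lt 5 0) (code levelBody)) (code [.radd 0 0 2]))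

/-- The evaluation of the plain switch distribution. -/
def switchProg : Prog :=
  .seq (code initCode) (.seq (.while (.lt 5 0) (code initBody)) (.seq (code [.radd 0 0 2])
    (.seq (.while (.lt 9 8) levelProg) (.seq (code tailStart)
      (.seq (.while (.lt 5 0) (code tailBody)) (code [.radd 0 0 2]))))))

/-- What stays true of the memory throughout. -/
structure Fixed (p : ℕ → ℝ) (x : List (Fin D)) (σ : Mem) : Prop where
  len : σ.word 0 = x.length
  alph : σ.word 1 = D
  one : σ.word 2 = 1
  lenSucc : σ.word 3 = x.length + 1
  zero : σ.word 9 = 0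
  rone : σ.real 1 = 1
  letters : ∀ m, σ.warr 0 m = letter x m
  coeffs : ∀ m < x.length, σ.rarr 0 m = p m

/-- The memory when level `0` has been evaluated up to position `n`. -/
structure InitInv (p : ℕ → ℝ) (x : List (Fin D)) (n : ℕ) (σ : Mem) : Prop where
  fixed : Fixed p x σ
  level : σ.word 4 = 0
  pos : σ.word 5 = n
  total : σ.word 8 = 1
  acc : σ.real 0 = 0
  mass : σ.real 2 = partialAux p x n 0
  mark : σ.real 3 = 1 / (D : ℝ)
  reps : ∀ m, σ.warr 1 m = 0
  counts : ∀ m < n, σ.warr 2 m = m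
  ctab : ∀ m, σ.warr 3 m = 0
  rtab : ∀ m, σ.warr 4 m = 0
  marks : ∀ m < n, σ.rarr 1 m = 1 / (D : ℝ)
  masses : ∀ m < n, σ.rarr 2 m = partialAux p x m 0

/-- The memory when the levels up to `k` have been evaluated. -/
structure OuterInv (p : ℕ → ℝ) (x : List (Fin D)) (k : ℕ) (σ : Mem) : Prop where
  fixed : Fixed p x σ
  level : σ.word 4 = k
  unrepeated : σ.word 8 = 0 → ∀ m ≤ x.length, ctxCount x k m = 0
  repeated : σ.word 8 ≠ 0 → k ≤ depth x
  acc : σ.real 0 = ∑ j ∈ Finset.range (k + 1), partialAux p x x.length j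
  reps : ∀ m < x.length, σ.warr 1 m = ctxRep x k m
  counts : ∀ m < x.length, σ.warr 2 m = ctxCount x k m
  ctab : ∀ a, (k + 1) * (x.length + 1) * D ≤ a → σ.warr 3 a = 0
  rtab : ∀ a, (k + 1) * (x.length + 1) * D ≤ a → σ.warr 4 a = 0
  marks : ∀ m < x.length, σ.rarr 1 m = markovAux x m k
  masses : ∀ m < x.length, σ.rarr 2 m = partialAux p x m k

/-- The memory when level `k + 1` has been evaluated up to position `n`. -/
structure InnerInv (p : ℕ → ℝ) (x : List (Fin D)) (k n : ℕ) (σ : Mem) : Prop where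
  fixed : Fixed p x σ
  level : σ.word 4 = k + 1
  pos : σ.word 5 = n
  rep : σ.word 6 = ctxRep x (k + 1) n
  count : σ.word 7 = ctxCount x (k + 1) n
  total : σ.word 8 = ∑ m ∈ Finset.range n, ctxCount x (k + 1) (m + 1)
  acc : σ.real 0 = ∑ j ∈ Finset.range (k + 1), partialAux p x x.length j
  mass : σ.real 2 = partialAux p x n (k + 1)
  reps : ∀ m < x.length, σ.warr 1 m = ctxRep x (if m < n then k + 1 else k) m
  counts : ∀ m < x.length, σ.warr 2 m = ctxCount x (if m < n then k + 1 else k) m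
  ctab : ∀ a, (k + 1) * (x.length + 1) * D ≤ a →
    σ.warr 3 a = ((Finset.Ico k n).filter fun m => ctxKey x k m = a).card
  rtab_new : ∀ a, (k + 1) * (x.length + 1) * D ≤ a → σ.warr 3 a = 0 → σ.warr 4 a = 0
  rtab : ∀ m, k ≤ m → m < n → σ.warr 4 (ctxKey x k m) = ctxRep x (k + 1) (m + 1)
  marks : ∀ m < x.length, σ.rarr 1 m = markovAux x m (if m < n then k + 1 else k)
  masses : ∀ m < x.length, σ.rarr 2 m = partialAux p x m (if m < n then k + 1 else k)

/-- The memory when the tail mass of level `K` has been evaluated up to position `n`. -/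
structure TailInv (p : ℕ → ℝ) (x : List (Fin D)) (K n : ℕ) (σ : Mem) : Prop where
  fixed : Fixed p x σ
  pos : σ.word 5 = n
  acc : σ.real 0 = ∑ j ∈ Finset.range (K + 1), partialAux p x x.length j
  mass : σ.real 2 = tailMass p x K n
  marks : ∀ m < x.length, σ.rarr 1 m = markovAux x m K
  masses : ∀ m < x.length, σ.rarr 2 m = partialAux p x m K

/-- A word capacity that suffices for the program. -/
structure Roomy (W : ℕ) (x : List (Fin D)) : Prop where
  len : x.length + 1 ≤ W
  key : (x.length * (x.length + 1) + x.length) * D + D ≤ W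
  total : x.length * x.length ≤ W

/-! ### Correctness of the phases -/

theorem InnerInv.step {W k n : ℕ} {σ : Mem} (hW : Roomy W x) (hk : k ≤ n) (hn : n < x.length)
    (h : InnerInv p x k n σ) :
    Reaches W (code levelBody) σ (InnerInv p x k (n + 1)) (levelBody.length + 1) := by
  obtain ⟨w, r, wa, ra⟩ := σ
  obtain ⟨⟨hlen, halph, hone, hM, hzero, hrone, hlet, hcoef⟩, hlevel, hpos, hrep, hcount, htotal,
    hacc, hmass, hreps, hcounts, hctab, hnew, hrtab, hmarks, hmasses⟩ := h
  simp only at *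
  have hr := hreps n hn
  have hc := hcounts n hn
  have hm := hmarks n hn
  have hP := hmasses n hn
  have hp := hcoef n hn
  rw [if_neg (lt_irrefl n)] at hr hc hm hP
  have hkey : ((k + 1) * (x.length + 1) + ctxRep x k n) * D + letter x n = ctxKey x k n := rfl
  have hct : wa 3 (ctxKey x k n) = ctxCount x (k + 1) (n + 1) := by
    rw [hctab _ (le_ctxKey k n), ctxCount_succ_eq hk hn]
  have hrep_eq : ∀ m, k ≤ m → m ≤ n → ctxKey x k m = ctxKey x k n →
      ctxRep x (k + 1) (m + 1) = ctxRep x (k + 1) (n + 1) := fun m hkm hmn he => by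
    rw [ctxRep_eq_iff (by omega) (by omega), ← ctxKey_eq_iff hkm hk (by omega) hn]
    exact he
  -- For a new context the cell is still `0` and receives `n + 1`; for a known one it already holds
  -- the name and `0` is added.
  have hrt : wa 4 (ctxKey x k n) + (1 - ctxCount x (k + 1) (n + 1)) * (n + 1) =
      ctxRep x (k + 1) (n + 1) := by
    rcases Nat.eq_zero_or_pos (ctxCount x (k + 1) (n + 1)) with h0 | h0
    · rw [hnew _ (le_ctxKey k n) (hct.trans h0), h0,
        ctxRep_of_ctxCount_eq_zero (by omega) h0]
      omega
    · rw [Nat.sub_eq_zero_of_le h0, Nat.zero_mul, add_zero]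
      rw [ctxCount_succ_eq hk hn] at h0
      obtain ⟨m, hm⟩ := Finset.card_pos.1 h0
      simp only [Finset.mem_filter, Finset.mem_Ico] at hm
      rw [← hm.2, hrtab m hm.1.1 hm.1.2, hrep_eq m hm.1.1 hm.1.2.le hm.2]
  have htot : w 8 + ctxCount x (k + 1) (n + 1) =
      ∑ m ∈ Finset.range (n + 1), ctxCount x (k + 1) (m + 1) := by
    rw [Finset.sum_range_succ, htotal]
  refine reaches_code ?_ ?_
  · have hD : 0 < D := (Nat.zero_le _).trans_lt (letter_lt hn)
    have hl := letter_lt hn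
    have h1 : (k + 1) * (x.length + 1) + ctxRep x k n ≤
        x.length * (x.length + 1) + x.length := by
      have := ctxRep_le (x := x) k n
      exact Nat.add_le_add (Nat.mul_le_mul_right _ (by omega)) (by omega)
    have h2 := Nat.mul_le_mul_right D h1
    have h3 : (k + 1) * (x.length + 1) + ctxRep x k n ≤
        ((k + 1) * (x.length + 1) + ctxRep x k n) * D := Nat.le_mul_of_pos_right _ hD
    have h4 := hW.key
    have h5 := hW.len
    have h6 := ctxCount_le (x := x) (k + 1) (n + 1)
    have h7 := ctxRep_le (x := x) (k + 1) (n + 1)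
    have h8 : ∑ m ∈ Finset.range (n + 1), ctxCount x (k + 1) (m + 1) ≤ W := by
      refine le_trans (Finset.sum_le_card_nsmul _ _ x.length fun m hm => ?_) ?_
      · have := ctxCount_le (x := x) (k + 1) (m + 1)
        have := Finset.mem_range.1 hm
        omega
      · rw [Finset.card_range, smul_eq_mul]
        exact (Nat.mul_le_mul_right _ hn).trans hW.total
    have h9 : (ctxCount x k n : ℝ) + 1 ≠ 0 := by positivity
    have h10 : (1 - ctxCount x (k + 1) (n + 1)) * (n + 1) ≤ W := by omega
    simp [levelBody, Runnable, Instr.Enabled, Instr.apply, setCell_apply,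
      halph, hone, hM, hrone, hlet, hlevel, hpos, hr, hc, hm, hP, hp, hkey, hct, hrt, htot, h8,
      h9, h10]
    omega
  · simp only [levelBody, run, Instr.apply]
    constructor
    · constructor <;>
        simp [setCell_apply, hlen, halph, hone, hM, hzero, hrone, hlet,
          hpos]
      exact hcoef
    all_goals
      simp [setCell_apply, halph, hone, hM, hrone, hlet, hlevel, hpos,
        hr, hc, hm, hP, hp, hkey, hct, hrt, htot]
    case acc => exact hacc
    case mass => rw [partialAux, markovAux, hmass]
    case reps =>
      intro m hm
      rcases lt_trichotomy m n with h | rfl | h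
      · rw [if_neg h.ne, hreps m hm, if_pos h, if_pos h.le]
      · rw [if_pos rfl, if_pos le_rfl, hrep]
      · rw [if_neg h.ne', hreps m hm, if_neg h.not_gt, if_neg h.not_ge]
    case counts =>
      intro m hm
      rcases lt_trichotomy m n with h | rfl | h
      · rw [if_neg h.ne, hcounts m hm, if_pos h, if_pos h.le]
      · rw [if_pos rfl, if_pos le_rfl, hcount]
      · rw [if_neg h.ne', hcounts m hm, if_neg h.not_gt, if_neg h.not_ge]
    case ctab =>
      intro a ha
      rw [← Finset.insert_Ico_right_eq_Ico_add_one hk, Finset.filter_insert]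
      split_ifs with h1 h2 h2
      · rw [Finset.card_insert_of_notMem (by simp), ctxCount_succ_eq hk hn, h1]
      · exact absurd h1.symm h2
      · exact absurd h2.symm h1
      · exact hctab a ha
    case rtab_new =>
      intro a ha
      split_ifs with h1
      · simp
      · exact hnew a ha
    case rtab =>
      intro m hkm hmn
      split_ifs with h1
      · exact (hrep_eq m hkm hmn h1).symm
      · exact hrtab m hkm (lt_of_le_of_ne hmn fun h => h1 (by rw [h]))
    case marks =>
      intro m hm
      rcases lt_trichotomy m n with h | rfl | h
      · rw [if_neg h.ne, hmarks m hm, if_pos h, if_pos h.le]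
      · rw [if_pos rfl, if_pos le_rfl, markovAux]
      · rw [if_neg h.ne', hmarks m hm, if_neg h.not_gt, if_neg h.not_ge]
    case masses =>
      intro m hm
      rcases lt_trichotomy m n with h | rfl | h
      · rw [if_neg h.ne, hmasses m hm, if_pos h, if_pos h.le]
      · rw [if_pos rfl, if_pos le_rfl, hmass]
      · rw [if_neg h.ne', hmasses m hm, if_neg h.not_gt, if_neg h.not_ge]

theorem OuterInv.start {W k : ℕ} {σ : Mem} (hW : Roomy W x) (hk : k < x.length)
    (h : OuterInv p x k σ) :
    Reaches W (code levelStart) σ (InnerInv p x k k) (levelStart.length + 1) := by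
  obtain ⟨w, r, wa, ra⟩ := σ
  obtain ⟨⟨hlen, halph, hone, hM, hzero, hrone, hlet, hcoef⟩, hlevel, -, -, hacc, hreps, hcounts,
    hctab, hrtab, hmarks, hmasses⟩ := h
  simp only at *
  refine reaches_code ?_ ?_
  · have := hW.len
    simp [levelStart, Runnable, Instr.Enabled, Instr.apply, hone, hlevel]
    omega
  · simp only [levelStart, run, Instr.apply]
    constructor
    · constructor <;> simp [hlen, halph, hone, hM, hzero, hrone, hlet]
      exact hcoef
    all_goals simp [hone, hzero, hlevel]
    case rep => rw [ctxRep_of_lt (by omega)]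
    case count => rw [ctxCount_of_lt (by omega)]
    case total =>
      refine (Finset.sum_eq_zero fun m hm => ctxCount_of_lt ?_).symm
      have := Finset.mem_range.1 hm
      omega
    case acc => exact hacc
    case mass => rw [partialAux_of_lt (by omega)]
    case reps =>
      intro m hm
      split_ifs with h
      · rw [hreps m hm, ctxRep_of_lt h, ctxRep_of_lt (by omega)]
      · exact hreps m hm
    case counts =>
      intro m hm
      split_ifs with h
      · rw [hcounts m hm, ctxCount_of_lt h, ctxCount_of_lt (by omega)]
      · exact hcounts m hm
    case ctab => exact hctab
    case rtab_new => exact fun a ha _ => hrtab a ha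
    case rtab =>
      intro m h1 h2
      omega
    case marks =>
      intro m hm
      split_ifs with h
      · rw [hmarks m hm, markovAux, ctxCount_of_lt h, ctxCount_of_lt (by omega)]
        simp
      · exact hmarks m hm
    case masses =>
      intro m hm
      split_ifs with h
      · rw [hmasses m hm, partialAux_of_lt h, partialAux_of_lt (by omega)]
      · exact hmasses m hm

theorem InnerInv.finish {W k : ℕ} {σ : Mem} (h : InnerInv p x k x.length σ) :
    Reaches W (code [.radd 0 0 2]) σ (OuterInv p x (k + 1)) 2 := by
  obtain ⟨w, r, wa, ra⟩ := σ
  obtain ⟨⟨hlen, halph, hone, hM, hzero, hrone, hlet, hcoef⟩, hlevel, hpos, hrep, hcount, htotal,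
    hacc, hmass, hreps, hcounts, hctab, hnew, hrtab, hmarks, hmasses⟩ := h
  simp only at *
  -- All keys of the finished level lie below the interval of the next one.
  have htab : ∀ a, (k + 1 + 1) * (x.length + 1) * D ≤ a → wa 3 a = 0 := by
    intro a ha
    rw [hctab a (le_trans (by gcongr; omega) ha), Finset.card_eq_zero, Finset.filter_eq_empty_iff]
    intro m hm he
    exact (ctxKey_lt (k := k) (Finset.mem_Ico.1 hm).2).not_ge (he ▸ ha)
  refine reaches_code (by simp [Runnable, Instr.Enabled]) ?_
  simp only [run, Instr.apply]
  constructor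
  · constructor <;> simp [hlen, halph, hone, hM, hzero, hrone, hlet]
    exact hcoef
  all_goals simp
  case level => exact hlevel
  case unrepeated =>
    intro h0 m hm
    rcases m with _ | m
    · exact ctxCount_of_lt (by omega)
    · exact Finset.sum_eq_zero_iff.1 (htotal.symm.trans h0) m (Finset.mem_range.2 hm)
  case repeated =>
    intro h0
    obtain ⟨m, hm, hne⟩ := Finset.exists_ne_zero_of_sum_ne_zero (htotal ▸ h0)
    exact le_depth (Finset.mem_range.1 hm) (Nat.pos_of_ne_zero hne)
  case acc => rw [Finset.sum_range_succ, hacc, hmass]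
  case reps => exact fun m hm => by rw [hreps m hm, if_pos hm]
  case counts => exact fun m hm => by rw [hcounts m hm, if_pos hm]
  case ctab => exact htab
  case rtab => exact fun a ha => hnew a (le_trans (by gcongr; omega) ha) (htab a ha)
  case marks => exact fun m hm => by rw [hmarks m hm, if_pos hm]
  case masses => exact fun m hm => by rw [hmasses m hm, if_pos hm]

theorem OuterInv.step {W k : ℕ} {σ : Mem} (hW : Roomy W x) (hk : k < x.length)
    (h : OuterInv p x k σ) :
    Reaches W levelProg σ (OuterInv p x (k + 1)) (36 * x.length + 10) := by
  refine Reaches.mono ((h.start hW hk).seq fun τ hτ => Reaches.seq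
    (reaches_for (fun n σ h => ⟨h.pos, h.fixed.len⟩)
      (fun n σ hkn hn hI => hI.step hW hkn hn) hk.le hτ) fun τ hτ => hτ.finish) (fun τ h => h) ?_
  simp only [levelStart, levelBody, List.length_cons, List.length_nil]
  omega

theorem init_start {W : ℕ} (hW : Roomy W x) (hx : x ≠ []) :
    Reaches W (code initCode) (input p x) (InitInv p x 0) 8 := by
  have h0 : 0 < x.length := List.length_pos_iff.2 hx
  have hD : 0 < D := (Nat.zero_le _).trans_lt (letter_lt h0)
  refine reaches_code ?_ ?_
  · have := hW.len
    simp [initCode, Runnable, Instr.Enabled, Instr.apply, input, hD.ne']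
    omega
  · simp only [initCode, run, Instr.apply]
    constructor
    · constructor <;> simp [input, letter]
      intro m hm h
      omega
    all_goals simp [input, partialAux]

theorem InitInv.step {W n : ℕ} {σ : Mem} (hW : Roomy W x) (hn : n < x.length)
    (h : InitInv p x n σ) :
    Reaches W (code initBody) σ (InitInv p x (n + 1)) 8 := by
  obtain ⟨w, r, wa, ra⟩ := σ
  obtain ⟨⟨hlen, halph, hone, hM, hzero, hrone, hlet, hcoef⟩, hlevel, hpos, htotal, hacc, hmass,
    hmark, hreps, hcounts, hctab, hrtab, hmarks, hmasses⟩ := h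
  simp only at *
  refine reaches_code ?_ ?_
  · have := hW.len
    simp [initBody, Runnable, Instr.Enabled, Instr.apply, hone, hpos]
    omega
  · simp only [initBody, run, Instr.apply]
    constructor
    · constructor <;>
        simp [setCell_apply, hlen, halph, hone, hM, hzero, hrone, hlet]
      exact hcoef
    all_goals
      simp [setCell_apply, hone, hlevel, hpos, htotal, hacc, hmark, hreps,
        hctab, hrtab, hcoef n hn]
    case mass => rw [partialAux, markovAux, hmass, one_div]
    case counts =>
      intro m hm
      split_ifs with h
      · exact h.symm
      · exact hcounts m (by omega)
    case marks =>
      intro m hm hne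
      simpa using hmarks m (by omega)
    case masses =>
      intro m hm
      split_ifs with h
      · rw [h, hmass]
      · exact hmasses m (by omega)

theorem InitInv.finish {W : ℕ} {σ : Mem} (h : InitInv p x x.length σ) :
    Reaches W (code [.radd 0 0 2]) σ (OuterInv p x 0) 2 := by
  obtain ⟨w, r, wa, ra⟩ := σ
  obtain ⟨⟨hlen, halph, hone, hM, hzero, hrone, hlet, hcoef⟩, hlevel, hpos, htotal, hacc, hmass,
    hmark, hreps, hcounts, hctab, hrtab, hmarks, hmasses⟩ := h
  simp only at *
  refine reaches_code (by simp [Runnable, Instr.Enabled]) ?_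
  simp only [run, Instr.apply]
  constructor
  · constructor <;> simp [hlen, halph, hone, hM, hzero, hrone, hlet]
    exact hcoef
  all_goals simp [hlevel, htotal, hacc, hmass, hreps, hctab, hrtab, ctxRep_zero, ctxCount_zero]
  case counts => exact hcounts
  case marks => simpa [markovAux] using hmarks
  case masses => exact hmasses

theorem OuterInv.tail {W K : ℕ} {σ : Mem} (h : OuterInv p x K σ) :
    Reaches W (code tailStart) σ (TailInv p x K 0) 3 := by
  obtain ⟨w, r, wa, ra⟩ := σ
  obtain ⟨⟨hlen, halph, hone, hM, hzero, hrone, hlet, hcoef⟩, -, -, -, hacc, -, -, -, -, hmarks,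
    hmasses⟩ := h
  simp only at *
  refine reaches_code (by simp [tailStart, Runnable, Instr.Enabled]) ?_
  simp only [tailStart, run, Instr.apply]
  constructor
  · constructor <;> simp [hlen, halph, hone, hM, hzero, hrone, hlet]
    exact hcoef
  all_goals simp [hzero, hacc, tailMass]
  case marks => exact hmarks
  case masses => exact hmasses

theorem TailInv.step {W K n : ℕ} {σ : Mem} (hW : Roomy W x) (hn : n < x.length)
    (h : TailInv p x K n σ) :
    Reaches W (code tailBody) σ (TailInv p x K (n + 1)) 9 := by
  obtain ⟨w, r, wa, ra⟩ := σ
  obtain ⟨⟨hlen, halph, hone, hM, hzero, hrone, hlet, hcoef⟩, hpos, hacc, hmass, hmarks,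
    hmasses⟩ := h
  simp only at *
  refine reaches_code ?_ ?_
  · have := hW.len
    simp [tailBody, Runnable, Instr.Enabled, Instr.apply, hone, hpos]
    omega
  · simp only [tailBody, run, Instr.apply]
    constructor
    · constructor <;> simp [hlen, halph, hone, hM, hzero, hrone, hlet]
      exact hcoef
    all_goals
      simp [hone, hrone, hpos, hacc, hmass, tailMass, hcoef n hn,
        hmarks n hn, hmasses n hn]
    case marks => exact hmarks
    case masses => exact hmasses

theorem TailInv.finish {W K : ℕ} {σ : Mem} (hx : x ≠ []) (hK : 0 < K)
    (hunrep : ∀ m ≤ x.length, ctxCount x K m = 0) (h : TailInv p x K x.length σ) :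
    Reaches W (code [.radd 0 0 2]) σ (fun τ => τ.real 0 = switchProb p x) 2 := by
  refine reaches_code (by simp [Runnable, Instr.Enabled]) ?_
  simp [run, Instr.apply, h.acc, h.mass, switchProb_eq_add_tailMass hx hK hunrep]

/-! ### Total running time and word size -/

theorem switchProg_reaches {W : ℕ} (hW : Roomy W x) (hx : x ≠ []) :
    Reaches W switchProg (input p x) (fun τ => τ.real 0 = switchProb p x)
      ((depth x + 1) * (36 * x.length + 11) + 19 * x.length + 18) := by
  have h0 : 0 < x.length := List.length_pos_iff.2 hx
  have hgo : ∀ k σ, OuterInv p x k σ → (Test.lt 9 8).Holds σ → k ≤ depth x := fun k σ h hb =>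
    h.repeated (Nat.ne_of_gt ((Nat.zero_le _).trans_lt hb))
  have hunrep : ∀ K σ, OuterInv p x K σ → ¬ (Test.lt 9 8).Holds σ →
      0 < K ∧ ∀ m ≤ x.length, ctxCount x K m = 0 := fun K σ h hb => by
    have hs := h.unrepeated (by simpa [Test.Holds, h.fixed.zero] using hb)
    refine ⟨Nat.pos_of_ne_zero fun hK => ?_, hs⟩
    have := hs x.length le_rfl
    -- The loop cannot stop at level `0`: the empty context ending at the last position has
    -- `x.length > 0` earlier occurrences.
    rw [hK, ctxCount_zero] at this
    omega
  refine Reaches.mono ((init_start hW hx).seq fun τ hτ => Reaches.seq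
    (reaches_for (fun n σ h => ⟨h.pos, h.fixed.len⟩)
      (fun n σ _ hn hI => hI.step hW hn) h0.le hτ) fun τ hτ => Reaches.seq hτ.finish
    fun τ hτ => Reaches.seq (reaches_while hgo
      (fun k σ h hb => h.step hW ((hgo k σ h hb).trans_lt (depth_lt hx))) hτ)
    fun τ ⟨K, hτ, hb⟩ => Reaches.seq hτ.tail
    fun τ' hτ' => Reaches.seq (reaches_for (fun n σ h => ⟨h.pos, h.fixed.len⟩)
      (fun n σ _ hn hI => hI.step hW hn) h0.le hτ')
    fun τ'' hτ'' => hτ''.finish hx (hunrep K τ hτ hb).1 (hunrep K τ hτ hb).2) (fun τ h => h) ?_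
  simp only [Nat.sub_zero]
  rw [show 36 * x.length + 10 + 1 = 36 * x.length + 11 by omega]
  omega

/-- Addresses are of size `D` times a quadratic in the length; two factors of the power pay for the
quadratic and `D` more for the alphabet, as `D < (x.length + 2) ^ D`. -/
theorem roomy_pow {C : ℕ} (hC : D + 2 ≤ C) : Roomy ((x.length + 2) ^ C) x := by
  have h1 : (x.length + 2) ^ (D + 2) ≤ (x.length + 2) ^ C := Nat.pow_le_pow_right (by omega) hC
  have h2 : D + 1 ≤ (x.length + 2) ^ D :=
    Nat.lt_pow_self (by omega)
  rw [pow_add] at h1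
  have h3 := Nat.mul_le_mul_right ((x.length + 2) ^ 2) h2
  constructor <;> nlinarith [Nat.zero_le (D * x.length)]

end PlainSwitch
end

theorem theorem2 :
    ∃ prog : PlainSwitch.Prog, ∀ D : ℕ, ∃ C : ℕ,
      ∀ p : ℕ → ℝ, PlainSwitch.IsSwitchCoeff p →
        ∀ x : List (Fin D), x ≠ [] →
          ∃ (τ : PlainSwitch.Mem) (t : ℕ),
            PlainSwitch.Exec ((x.length + 2) ^ C) prog (PlainSwitch.input p x) τ t ∧
            τ.real 0 = PlainSwitch.switchProb p x ∧
            t ≤ C * max 1 (x.length * PlainSwitch.depth x) := by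
  refine ⟨PlainSwitch.switchProg, fun D => ⟨150 * (D + 1), fun p _ x hx => ?_⟩⟩
  obtain ⟨τ, t, he, hτ, ht⟩ := PlainSwitch.switchProg_reaches (p := p) (x := x)
    (PlainSwitch.roomy_pow (C := 150 * (D + 1)) (by omega)) hx
  refine ⟨τ, t, he, hτ, ht.trans ?_⟩
  have h0 : 0 < x.length := List.length_pos_iff.2 hx
  rcases Nat.eq_zero_or_pos (PlainSwitch.depth x) with hd | hd
  -- Here the bound is `55 * x.length + 29` with `x.length ≤ D`, which is where the time constant
  -- depends on `D`.
  · have := PlainSwitch.length_le_of_depth_eq_zero hd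
    rw [hd, Nat.mul_zero, max_eq_left (by omega)]
    omega
  -- Length, depth and `1` are all at most the product, so the bound is at most `131` times the
  -- product.
  · have h1 : x.length ≤ x.length * PlainSwitch.depth x := Nat.le_mul_of_pos_right _ hd
    have h2 : PlainSwitch.depth x ≤ x.length * PlainSwitch.depth x := Nat.le_mul_of_pos_left _ h0
    rw [max_eq_right (by omega)]
    nlinarith [Nat.zero_le (D * (x.length * PlainSwitch.depth x))]
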